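/- For $n\ge 0$ let $b_{4,9}(n)$ denote the number of partitions of $n$ in which no part is divisible by $4$ and no part is divisible by $9$ (so $b_{4,9}(0)=1$), and for $i\ge 1$ let $f_i=\prod_{m=1}^{\infty}(1-q^{im})\in\mathbb{Z}[[q]]$. Two power series in $\mathbb{Z}[[q]]$ are called congruent modulo an integer $M$ if their corresponding coefficients are congruent modulo $M$. Then: (i) $b_{4,9}(8n+7)\equiv 0\pmod{12}$ for all $n\ge 0$; (ii) $b_{4,9}(16n+15)\equiv 0\pmod{8}$ for all $n\ge 0$; (iii) $\displaystyle\sum_{n=0}^{\infty}b_{4,9}(16n+7)q^n\equiv 4f_1^6f_3\pmod{8}$; (iv) $b_{4,9}(32n+29)\equiv 5\,b_{4,9}(16n+15)\pmod{9}$ for all $n\ge 0$. -/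

import Mathlib

open scoped PowerSeries PowerSeries.WithPiTopology

/-- `regularPartitionCount l k n` is `b_{l,k}(n)`: the number of partitions of `n` into parts
that are divisible neither by `l` nor by `k`. The empty partition gives `b_{l,k}(0) = 1`. -/
def regularPartitionCount (l k n : ℕ) : ℕ :=
  (Nat.Partition.restricted n (fun d => ¬ l ∣ d ∧ ¬ k ∣ d)).card

/-- `eulerProduct i` is the formal power series `f_i = (q^i; q^i)_∞ = ∏_{m ≥ 0} (1 - q^i (q^i)^m)`
with integer coefficients (with respect to coefficientwise convergence). -/
noncomputable def eulerProduct (i : ℕ) : ℤ⟦X⟧ :=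
  ∏' m : ℕ, (1 - (PowerSeries.X : ℤ⟦X⟧) ^ i * ((PowerSeries.X : ℤ⟦X⟧) ^ i) ^ m)

/-- The infinite product defining `f_i` converges for every `i ≥ 1`. -/
theorem multipliable_eulerProduct (i : ℕ) (hi : 0 < i) :
    Multipliable fun m : ℕ =>
      (1 - (PowerSeries.X : ℤ⟦X⟧) ^ i * ((PowerSeries.X : ℤ⟦X⟧) ^ i) ^ m) := by
  simp_rw [sub_eq_add_neg]
  apply PowerSeries.WithPiTopology.multipliable_one_add_of_tendsto_order_atTop_nhds_top
  refine ENat.tendsto_nhds_top_iff_natCast_lt.mpr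
    (fun n => Filter.eventually_atTop.mpr ⟨n, ?_⟩)
  intro m hm
  rw [← pow_mul, ← pow_add, PowerSeries.order_neg, PowerSeries.order_X_pow]
  norm_cast
  nlinarith

/-- Congruence of integer power series modulo `m`: coefficientwise congruence. -/
def SeriesModEq (m : ℤ) (A B : ℤ⟦X⟧) : Prop :=
  ∀ n : ℕ, PowerSeries.coeff n A ≡ PowerSeries.coeff n B [ZMOD m]

/-! The generating function of `b_{4,9}` is f₄f₉/(f₁f₃₆). Repeated 2-dissection (of f₉/f₁, then
f₃/f₁³ or its square, then 1/f₁⁴) gives exact formulas: ∑b(2n+1)qⁿ = f₂³f₃/(f₁³f₆), ∑b(4n+3)qⁿ =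
3f₂²f₆²/f₁⁴, ∑b(8n+5)qⁿ = 6f₂⁸f₃²/f₁¹⁰, ∑b(8n+7)qⁿ = 12f₂²f₃²f₄⁴/f₁⁸. The factor 12 is (i). Since
f_i² ≡ f_{2i} mod 2, the cofactor of 12 is congruent to f₂⁶f₆, a series in q²: its odd coefficients
give (ii) and its even ones (iii). Since f_i³ ≡ f_{3i} mod 3, the cofactors of 6 and 3 agree mod 3,
whence b(8n+5) ≡ 5b(4n+3) mod 9, which contains (iv).

The dissections rest on the Jacobi triple product `theta_eq_qProd`, which turns theta series into
products of the f_i, and on `theta_mul_theta`, which splits a product of two theta series. Every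
identity is stated with denominators cleared, and common factors are cancelled in the domain ℤ⟦X⟧.
-/

open PowerSeries Filter in
/-- A product of series `1 + g m` with `X ^ m ∣ g m` converges. -/
theorem multipliable_one_add_of_X_pow_dvd {g : ℕ → ℤ⟦X⟧} (h : ∀ m, X ^ m ∣ g m) :
    Multipliable fun m => 1 + g m := by
  apply WithPiTopology.multipliable_one_add_of_tendsto_order_atTop_nhds_top
  refine ENat.tendsto_nhds_top_iff_natCast_lt.mpr fun n =>
    eventually_atTop.mpr ⟨n + 1, fun m hm => ?_⟩
  have h1 : (m : ℕ∞) ≤ (g m).order := nat_le_order _ _ (X_pow_dvd_iff.mp (h m))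
  exact lt_of_lt_of_le (by exact_mod_cast hm) h1

/-! ### Infinite products over arithmetic progressions -/

/-- The product `∏ (1 + s X ^ (a + N m))` over `m ≥ 0`. -/
noncomputable def qProd (s : ℤ) (a N : ℕ) : ℤ⟦X⟧ :=
  ∏' m : ℕ, (1 + (s : ℤ⟦X⟧) * PowerSeries.X ^ (a + N * m))

section qProd
open PowerSeries

theorem multipliable_qProd (s : ℤ) (a : ℕ) {N : ℕ} (hN : 0 < N) :
    Multipliable fun m : ℕ => (1 + (s : ℤ⟦X⟧) * X ^ (a + N * m)) :=
  multipliable_one_add_of_X_pow_dvd fun m =>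
    Dvd.dvd.mul_left (pow_dvd_pow _ (by nlinarith)) _

theorem eulerProduct_eq_qProd (k : ℕ) : eulerProduct k = qProd (-1) k k := by
  unfold eulerProduct qProd
  congr 1; ext1 m
  push_cast
  ring

theorem constantCoeff_qProd (s : ℤ) {a N : ℕ} (ha : 0 < a) (hN : 0 < N) :
    constantCoeff (qProd s a N) = 1 := by
  unfold qProd
  rw [(multipliable_qProd s a hN).map_tprod _ (WithPiTopology.continuous_constantCoeff ℤ)]
  simp [ha.ne']

theorem isUnit_eulerProduct {k : ℕ} (hk : 0 < k) : IsUnit (eulerProduct k) := by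
  rw [isUnit_iff_constantCoeff, eulerProduct_eq_qProd, constantCoeff_qProd _ hk hk]
  exact isUnit_one

theorem eulerProduct_ne_zero {k : ℕ} (hk : 0 < k) : eulerProduct k ≠ 0 :=
  (isUnit_eulerProduct hk).ne_zero

theorem qProd_two_split (s : ℤ) (a : ℕ) {N : ℕ} (hN : 0 < N) :
    qProd s a N = qProd s a (2 * N) * qProd s (a + N) (2 * N) := by
  have h1 := multipliable_qProd s a (N := 2 * N) (by omega)
  have h2 := multipliable_qProd s (a + N) (N := 2 * N) (by omega)
  unfold qProd
  rw [← tprod_even_mul_odd]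
  · congr 1 <;> · congr 1; ext1 m; congr 3; ring
  · convert h1 using 5; ring
  · convert h2 using 5; ring

theorem qProd_three_split (s : ℤ) (a : ℕ) {N : ℕ} (hN : 0 < N) :
    qProd s a N = qProd s a (3 * N) * qProd s (a + N) (3 * N) * qProd s (a + 2 * N) (3 * N) := by
  have h0 := (multipliable_qProd s a hN).hasProd.tendsto_prod_nat.comp
    (Filter.tendsto_id.const_mul_atTop' (by norm_num : 0 < 3))
  have h1 := (multipliable_qProd s a (N := 3 * N) (by omega)).hasProd.tendsto_prod_nat
  have h2 := (multipliable_qProd s (a + N) (N := 3 * N) (by omega)).hasProd.tendsto_prod_nat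
  have h3 := (multipliable_qProd s (a + 2 * N) (N := 3 * N) (by omega)).hasProd.tendsto_prod_nat
  refine tendsto_nhds_unique h0 (((h1.mul h2).mul h3).congr fun n => ?_)
  simp only [Function.comp_apply, id]
  induction n with
  | zero => simp
  | succ n ih =>
    rw [show 3 * (n + 1) = 3 * n + 1 + 1 + 1 by ring]
    simp only [Finset.prod_range_succ]
    rw [← ih, show a + N * (3 * n) = a + 3 * N * n by ring,
      show a + N * (3 * n + 1) = a + N + 3 * N * n by ring,
      show a + N * (3 * n + 1 + 1) = a + 2 * N + 3 * N * n by ring]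
    ring

theorem qProd_one_mul_qProd_neg_one (a : ℕ) {N : ℕ} (hN : 0 < N) :
    qProd 1 a N * qProd (-1) a N = qProd (-1) (2 * a) (2 * N) := by
  unfold qProd
  rw [← (multipliable_qProd 1 a hN).tprod_mul (multipliable_qProd (-1) a hN)]
  congr 1; ext1 m
  push_cast
  ring

/-- The factor at m = 0 is 1 + q⁰ = 2; the others are a shift of the product starting at N. -/
theorem qProd_one_zero {N : ℕ} (hN : 0 < N) : qProd 1 0 N = 2 * qProd 1 N N := by
  unfold qProd
  have h := (multipliable_qProd 1 N hN)
  have : (fun m : ℕ => (1 + ((1 : ℤ) : ℤ⟦X⟧) * X ^ (N + N * m))) =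
    (fun m : ℕ => (1 + ((1 : ℤ) : ℤ⟦X⟧) * X ^ (0 + N * (m + 1)))) := by
    ext1 m; congr 3; ring
  rw [this] at h ⊢
  rw [tprod_eq_zero_mul' (f := fun m : ℕ => (1 + ((1 : ℤ) : ℤ⟦X⟧) * X ^ (0 + N * m))) h]
  norm_num

theorem continuous_expand {k : ℕ} (hk : k ≠ 0) :
    Continuous (expand k hk : ℤ⟦X⟧ → ℤ⟦X⟧) := by
  refine continuous_iff_continuousAt.mpr fun f => ?_
  refine (WithPiTopology.tendsto_iff_coeff_tendsto ℤ _ _ _).mpr fun d => ?_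
  by_cases h : k ∣ d
  · obtain ⟨m, rfl⟩ := h
    simp only [coeff_expand_mul]
    exact (WithPiTopology.continuous_coeff ℤ m).continuousAt
  · simp only [coeff_expand_of_not_dvd k hk _ h]
    exact tendsto_const_nhds

theorem expand_eulerProduct {k : ℕ} (hk : k ≠ 0) {i : ℕ} (hi : 0 < i) :
    expand k hk (eulerProduct i) = eulerProduct (k * i) := by
  rw [eulerProduct_eq_qProd, eulerProduct_eq_qProd]
  unfold qProd
  rw [(multipliable_qProd (-1) i hi).map_tprod _ (continuous_expand hk)]
  congr 1; ext1 m
  simp only [map_add, map_mul, map_one, map_pow, expand_X, map_intCast, ← pow_mul]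
  congr 3; ring

end qProd

/-! ### Ramanujan's theta series and their dissections -/

/-- The triangular number `n (n + 1) / 2`, for `n : ℤ`. -/
def tri (n : ℤ) : ℕ := (n * (n + 1) / 2).toNat

theorem two_mul_tri (n : ℤ) : 2 * (tri n : ℤ) = n * (n + 1) := by
  have h : 0 ≤ n * (n + 1) := by
    rcases le_or_gt 0 n with h | h
    · positivity
    · exact mul_nonneg_of_nonpos_of_nonpos h.le (by omega)
  have h2 := Int.even_mul_succ_self n
  unfold tri
  rw [Int.toNat_of_nonneg (by omega)]
  exact Int.mul_ediv_cancel' h2.two_dvd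

theorem tri_cast_rat (n : ℤ) : (tri n : ℚ) = n * (n + 1) / 2 := by
  have h := two_mul_tri n
  qify at h
  linarith

theorem natAbs_le_tri_add_one (n : ℤ) : n.natAbs ≤ tri n + 1 := by
  have h := two_mul_tri n
  zify
  rcases abs_cases n with ⟨h1, h2⟩ | ⟨h1, h2⟩ <;> rw [h1]
  · nlinarith
  · rcases eq_or_lt_of_le (show n ≤ -1 by omega) with h3 | h3
    · omega
    · nlinarith [mul_nonneg (show 0 ≤ -n - 1 by omega) (show 0 ≤ -n - 2 by omega)]

/-- Each exponent occurs for finitely many n, which gives summability; the same bound later controls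
the tail in the triple product. -/
theorem natAbs_le_theta_exponent {a b : ℕ} (h : 0 < a + b) (n : ℤ) :
    n.natAbs ≤ a * tri n + b * tri (-n) + 1 := by
  have h1 := natAbs_le_tri_add_one n
  have h2 := natAbs_le_tri_add_one (-n)
  rw [Int.natAbs_neg] at h2
  rcases Nat.eq_zero_or_pos a with rfl | ha
  · nlinarith
  · nlinarith [Nat.zero_le (b * tri (-n))]

theorem finite_natAbs_le (d : ℕ) : {n : ℤ | n.natAbs ≤ d}.Finite := by
  refine (Set.finite_Icc (-(d : ℤ)) d).subset fun n hn => ?_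
  simp only [Set.mem_ofPred_eq, Set.mem_Icc] at *
  omega

open PowerSeries in
theorem summable_intCast_mul_X_pow {ι : Type*} (c : ι → ℤ) (e : ι → ℕ)
    (h : ∀ d, {i | e i = d}.Finite) : Summable fun i => (c i : ℤ⟦X⟧) * X ^ e i := by
  refine (WithPiTopology.summable_iff_summable_coeff ℤ).mpr fun d =>
    summable_of_hasFiniteSupport ((h d).subset fun i hi => ?_)
  by_contra hne
  refine hi ?_
  change coeff d ((c i : ℤ⟦X⟧) * X ^ e i) = 0
  rw [show (c i : ℤ⟦X⟧) = C (c i) by simp, coeff_C_mul, coeff_X_pow, if_neg, mul_zero]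
  exact fun h => hne h.symm

theorem hasSum_of_forall_eq {ι : Type*} {f g : ι → ℤ⟦X⟧} {a : ℤ⟦X⟧} (h : HasSum f a)
    (e : ∀ i, g i = f i) : HasSum g a :=
  funext e ▸ h

/-- The general term of Ramanujan's theta series `f(s q^a, s q^b)`. -/
noncomputable def thetaTerm (s : ℤˣ) (a b : ℕ) (n : ℤ) : ℤ⟦X⟧ :=
  (((s ^ n : ℤˣ) : ℤ) : ℤ⟦X⟧) * PowerSeries.X ^ (a * tri n + b * tri (-n))

/-- Ramanujan's theta series `f(s q^a, s q^b)`. -/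
noncomputable def theta (s : ℤˣ) (a b : ℕ) : ℤ⟦X⟧ := ∑' n : ℤ, thetaTerm s a b n

section theta
open PowerSeries

theorem summable_thetaTerm (s : ℤˣ) {a b : ℕ} (h : 0 < a + b) : Summable (thetaTerm s a b) := by
  refine summable_intCast_mul_X_pow _ _ fun d => (finite_natAbs_le (d + 1)).subset fun n hn => ?_
  have := natAbs_le_theta_exponent h n
  simp only [Set.mem_ofPred_eq] at *
  omega

theorem hasSum_theta (s : ℤˣ) {a b : ℕ} (h : 0 < a + b) :
    HasSum (thetaTerm s a b) (theta s a b) :=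
  (summable_thetaTerm s h).hasSum

theorem thetaTerm_neg (s : ℤˣ) (a b : ℕ) (n : ℤ) : thetaTerm s a b (-n) = thetaTerm s b a n := by
  unfold thetaTerm
  rw [zpow_neg, Int.units_inv_eq_self, neg_neg, add_comm]

theorem theta_comm (s : ℤˣ) (a b : ℕ) : theta s a b = theta s b a := by
  unfold theta
  rw [← (Equiv.neg ℤ).tsum_eq]
  simp [thetaTerm_neg]

theorem thetaTerm_mul_thetaTerm (s t : ℤˣ) (a b c d : ℕ) (m n : ℤ) :
    thetaTerm s a b m * thetaTerm t c d n = (((s ^ m * t ^ n : ℤˣ) : ℤ) : ℤ⟦X⟧) *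
      X ^ (a * tri m + b * tri (-m) + (c * tri n + d * tri (-n))) := by
  unfold thetaTerm
  push_cast
  ring

theorem thetaTerm_mul_hasSum (s t : ℤˣ) {a b c d : ℕ} (h : 0 < a + b) (h' : 0 < c + d) :
    HasSum (fun p : ℤ × ℤ => thetaTerm s a b p.1 * thetaTerm t c d p.2)
      (theta s a b * theta t c d) := by
  refine (hasSum_theta s h).mul (hasSum_theta t h') ?_
  have := summable_intCast_mul_X_pow (fun p : ℤ × ℤ => ((s ^ p.1 : ℤˣ) : ℤ) * ((t ^ p.2 : ℤˣ) : ℤ))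
    (fun p => (a * tri p.1 + b * tri (-p.1)) + (c * tri p.2 + d * tri (-p.2))) fun k =>
    ((finite_natAbs_le (k + 1)).prod (finite_natAbs_le (k + 1))).subset fun p hp => ?_
  · refine this.congr fun p => ?_
    unfold thetaTerm
    push_cast
    ring
  · have h1 := natAbs_le_theta_exponent h p.1
    have h2 := natAbs_le_theta_exponent h' p.2
    simp only [Set.mem_ofPred_eq, Set.mem_prod] at *
    omega

/-- Pairs of integers `(m, n)`, split according to the parity of `m + n`. -/
noncomputable def paritySplit : (ℤ × ℤ) ⊕ (ℤ × ℤ) ≃ ℤ × ℤ :=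
  Equiv.ofBijective
    (Sum.elim (fun p => (p.1 + p.2, p.1 - p.2)) (fun p => (p.1 + p.2, p.1 - p.2 + 1))) (by
    constructor
    · rintro (⟨u, v⟩ | ⟨u, v⟩) (⟨u', v'⟩ | ⟨u', v'⟩) h <;>
        simp only [Sum.elim_inl, Sum.elim_inr, Prod.mk.injEq, Sum.inl.injEq, Sum.inr.injEq,
          reduceCtorEq] at * <;> omega
    · rintro ⟨m, n⟩
      rcases Int.emod_two_eq_zero_or_one (m + n) with h | h
      · exact ⟨Sum.inl ((m + n) / 2, m - (m + n) / 2), by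
          simp only [Sum.elim_inl, Prod.mk.injEq]; omega⟩
      · exact ⟨Sum.inr ((m + n) / 2, m - (m + n) / 2), by
          simp only [Sum.elim_inr, Prod.mk.injEq]; omega⟩)

/-- Sum over pairs (m, n) and split by the parity of m + n. In the coordinates m' + n' and m' - n'
(or m' - n' + 1) the quadratic exponent loses its cross term, because both factors have the same
total a + b = 2g + u + v; each half is then again a product of two theta series. -/
theorem theta_mul_theta (s t : ℤˣ) (g u v : ℕ) (h : 0 < g) :
    theta s (g + u) (g + v) * theta t g (g + u + v) =
      theta (s * t) (2 * g + u) (2 * g + u + 2 * v) * theta (s * t) (2 * g + 2 * u + v) (2 * g + v)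
      + ((t : ℤ) : ℤ⟦X⟧) * X ^ g *
        (theta (s * t) v (4 * g + 2 * u + v) * theta (s * t) u (4 * g + u + 2 * v)) := by
  have key := thetaTerm_mul_hasSum s t (a := g + u) (b := g + v) (c := g) (d := g + u + v)
    (by omega) (by omega)
  have h1 := thetaTerm_mul_hasSum (s * t) (s * t) (a := 2 * g + u) (b := 2 * g + u + 2 * v)
    (c := 2 * g + 2 * u + v) (d := 2 * g + v) (by omega) (by omega)
  have h2 := (thetaTerm_mul_hasSum (s * t) (s * t) (b := v) (a := 4 * g + 2 * u + v)
    (c := u) (d := 4 * g + u + 2 * v) (by omega) (by omega)).mul_left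
    (((t : ℤ) : ℤ⟦X⟧) * X ^ g)
  rw [theta_comm _ _ v] at h2
  rw [← paritySplit.hasSum_iff] at key
  refine key.unique (HasSum.sum ?_ ?_)
  · refine hasSum_of_forall_eq h1 fun p => ?_
    obtain ⟨m, n⟩ := p
    change thetaTerm s (g + u) (g + v) (m + n) * thetaTerm t g (g + u + v) (m - n) = _
    have e1 : (s ^ (m + n) : ℤˣ) * t ^ (m - n) = (s * t) ^ m * (s * t) ^ n := by
      rw [sub_eq_add_neg, zpow_add, zpow_add, zpow_neg, Int.units_inv_eq_self, mul_zpow, mul_zpow]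
      exact mul_mul_mul_comm _ _ _ _
    have e2 : (g + u) * tri (m + n) + (g + v) * tri (-(m + n)) +
        (g * tri (m - n) + (g + u + v) * tri (-(m - n))) =
        (2 * g + u) * tri m + (2 * g + u + 2 * v) * tri (-m) +
        ((2 * g + 2 * u + v) * tri n + (2 * g + v) * tri (-n)) := by
      qify
      simp only [tri_cast_rat]
      push_cast
      ring
    rw [thetaTerm_mul_thetaTerm, thetaTerm_mul_thetaTerm, e1, e2]
  · refine hasSum_of_forall_eq h2 fun p => ?_
    obtain ⟨m, n⟩ := p
    change thetaTerm s (g + u) (g + v) (m + n) * thetaTerm t g (g + u + v) (m - n + 1) = _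
    have e1 : (s ^ (m + n) : ℤˣ) * t ^ (m - n + 1) = t * ((s * t) ^ m * (s * t) ^ n) := by
      rw [sub_eq_add_neg, zpow_add, zpow_add, zpow_add, zpow_neg, Int.units_inv_eq_self, mul_zpow,
        mul_zpow, zpow_one, ← mul_assoc, mul_comm _ t]
      exact congrArg (t * ·) (mul_mul_mul_comm _ _ _ _)
    have e2 : (g + u) * tri (m + n) + (g + v) * tri (-(m + n)) +
        (g * tri (m - n + 1) + (g + u + v) * tri (-(m - n + 1))) =
        g + ((4 * g + 2 * u + v) * tri m + v * tri (-m) +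
        (u * tri n + (4 * g + u + 2 * v) * tri (-n))) := by
      qify
      simp only [tri_cast_rat]
      push_cast
      ring
    rw [thetaTerm_mul_thetaTerm, thetaTerm_mul_thetaTerm, e1, e2, pow_add]
    push_cast
    ring

/-- The integers, split according to their residue modulo `3`. -/
noncomputable def modThreeSplit : ℤ ⊕ (ℤ ⊕ ℤ) ≃ ℤ :=
  Equiv.ofBijective
    (Sum.elim (fun k => 3 * k) (Sum.elim (fun k => -3 * k + 1) (fun k => 3 * k + 2))) (by
    constructor
    · rintro (k | k | k) (l | l | l) h <;>
        simp only [Sum.elim_inl, Sum.elim_inr, Sum.inl.injEq, Sum.inr.injEq, reduceCtorEq] at * <;>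
        omega
    · intro n
      have h : n % 3 = 0 ∨ n % 3 = 1 ∨ n % 3 = 2 := by omega
      rcases h with h | h | h
      · exact ⟨Sum.inl (n / 3), by simp only [Sum.elim_inl]; omega⟩
      · exact ⟨Sum.inr (Sum.inl (-(n / 3))), by simp only [Sum.elim_inl, Sum.elim_inr]; omega⟩
      · exact ⟨Sum.inr (Sum.inr (n / 3)), by simp only [Sum.elim_inr]; omega⟩)

theorem theta_one_three_dissection (k : ℕ) (hk : 0 < k) :
    theta 1 0 k = 2 * theta 1 (3 * k) (6 * k) + X ^ k * theta 1 0 (9 * k) := by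
  have key := hasSum_theta 1 (a := 0) (b := k) (by omega)
  have h1 := hasSum_theta 1 (a := 3 * k) (b := 6 * k) (by omega)
  have h2 := (hasSum_theta 1 (a := 9 * k) (b := 0) (by omega)).mul_left (X ^ k)
  rw [theta_comm, two_mul, add_assoc, theta_comm _ 0 (9 * k)]
  rw [theta_comm, ← modThreeSplit.hasSum_iff] at key
  refine key.unique (HasSum.sum ?_ (HasSum.sum ?_ ?_))
  · refine hasSum_of_forall_eq h1 fun n => ?_
    change thetaTerm 1 0 k (3 * n) = _
    unfold thetaTerm
    have e : 0 * tri (3 * n) + k * tri (-(3 * n)) = 3 * k * tri n + 6 * k * tri (-n) := by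
      qify
      simp only [tri_cast_rat]
      push_cast
      ring
    rw [e, one_zpow, one_zpow]
  -- The exponent kn(n-1)/2 is invariant under n ↦ 1 - n, which exchanges the classes 0 and 1 mod 3:
  -- hence the coefficient 2.
  · refine hasSum_of_forall_eq h1 fun n => ?_
    change thetaTerm 1 0 k (-3 * n + 1) = _
    unfold thetaTerm
    have e : 0 * tri (-3 * n + 1) + k * tri (-(-3 * n + 1)) =
        3 * k * tri n + 6 * k * tri (-n) := by
      qify
      simp only [tri_cast_rat]
      push_cast
      ring
    rw [e, one_zpow, one_zpow]
  · refine hasSum_of_forall_eq h2 fun n => ?_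
    change thetaTerm 1 0 k (3 * n + 2) = _
    unfold thetaTerm
    have e : 0 * tri (3 * n + 2) + k * tri (-(3 * n + 2)) =
        k + (9 * k * tri n + 0 * tri (-n)) := by
      qify
      simp only [tri_cast_rat]
      push_cast
      ring
    rw [e, one_zpow, one_zpow, pow_add]
    ring

end theta

/-! ### Gaussian binomials and the finite q-binomial theorem -/

section qBinomial
variable {R : Type*} [CommRing R]

/-- `qBinom Q k l` is the Gaussian binomial coefficient "`k + l` choose `k`" at `Q`. -/
def qBinom (Q : R) : ℕ → ℕ → R
  | 0, _ => 1
  | _ + 1, 0 => 1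
  | k + 1, l + 1 => qBinom Q (k + 1) l + Q ^ (l + 1) * qBinom Q k (l + 1)

/-- The finite product `(Q; Q)_n`. -/
def qFactorial (Q : R) (n : ℕ) : R := ∏ i ∈ Finset.range n, (1 - Q ^ (i + 1))

theorem qFactorial_succ (Q : R) (n : ℕ) :
    qFactorial Q (n + 1) = qFactorial Q n * (1 - Q ^ (n + 1)) :=
  Finset.prod_range_succ _ _

theorem qBinom_zero_right (Q : R) (k : ℕ) : qBinom Q k 0 = 1 := by
  cases k <;> simp [qBinom]

theorem qBinom_mul_qFactorial (Q : R) (k l : ℕ) :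
    qBinom Q k l * qFactorial Q k * qFactorial Q l = qFactorial Q (k + l) := by
  induction k generalizing l with
  | zero => simp [qBinom, qFactorial]
  | succ k ihk =>
    induction l with
    | zero => simp [qBinom, qFactorial]
    | succ l ihl =>
      have h := ihk (l + 1)
      rw [← add_assoc] at h
      rw [show k + 1 + l = k + l + 1 by ring] at ihl
      rw [show k + 1 + (l + 1) = k + l + 1 + 1 by ring, qFactorial_succ Q (k + l + 1), qBinom,
        mul_sub, mul_one]
      rw [qFactorial_succ Q l] at h ⊢
      rw [qFactorial_succ Q k] at ihl ⊢
      linear_combination (1 - Q ^ (l + 1)) * ihl + Q ^ (l + 1) * (1 - Q ^ (k + 1)) * h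

/-- The `q`-binomial theorem. -/
theorem prod_add_mul_pow_eq_sum_qBinom (Q x z : R) (n : ℕ) :
    ∏ m ∈ Finset.range n, (x + z * Q ^ m) =
      ∑ p ∈ Finset.HasAntidiagonal.antidiagonal n,
        qBinom Q p.1 p.2 * (Q ^ p.1.choose 2 * z ^ p.1 * x ^ p.2) := by
  induction n with
  | zero => simp [qBinom]
  | succ n ih =>
    set t : ℕ × ℕ → R := fun p => qBinom Q p.1 p.2 * (Q ^ p.1.choose 2 * z ^ p.1 * x ^ p.2)
      with ht
    let u : ℕ × ℕ → R := fun p => match p with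
      | (_, 0) => 0
      | (k, l + 1) => x * t (k, l)
    -- `u` and `w` collect the contributions of x and zQⁿ from the last factor; the splitting is the
    -- Pascal recursion.
    let w : ℕ × ℕ → R := fun p => match p with
      | (0, _) => 0
      | (k + 1, l) => z * Q ^ n * t (k, l)
    have hsplit : ∀ p ∈ Finset.HasAntidiagonal.antidiagonal (n + 1), t p = u p + w p := by
      rintro ⟨k, l⟩ hp
      rw [Finset.HasAntidiagonal.mem_antidiagonal] at hp
      rcases k with _ | k <;> rcases l with _ | l
      · simp at hp
      · simp only [u, w, ht, qBinom, pow_succ]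
        ring
      · obtain rfl : k = n := by simpa using hp
        simp only [u, w, ht, qBinom_zero_right, Nat.choose_succ_succ' k 1,
          Nat.choose_one_right]
        ring
      · obtain rfl : k + l + 1 = n := by simp only at hp; omega
        simp only [u, w, ht, qBinom, Nat.choose_succ_succ' k 1, Nat.choose_one_right]
        ring
    rw [Finset.prod_range_succ, ih, Finset.sum_congr rfl hsplit, Finset.sum_add_distrib,
      Finset.Nat.sum_antidiagonal_succ', Finset.Nat.sum_antidiagonal_succ]
    simp only [u, w, zero_add, ← Finset.mul_sum]
    ring

end qBinomial

/-! ### The Jacobi triple product -/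

section jacobi
open PowerSeries Filter

theorem prod_neg_one_eq_qFactorial (N n : ℕ) :
    ∏ i ∈ Finset.range n, (1 + ((-1 : ℤ) : ℤ⟦X⟧) * X ^ (N + N * i)) =
      qFactorial ((X : ℤ⟦X⟧) ^ N) n := by
  refine Finset.prod_congr rfl fun i _ => ?_
  rw [← pow_mul]
  push_cast
  ring

theorem intCast_units_mul_self (s : ℤˣ) : ((s : ℤ) : ℤ⟦X⟧) * ((s : ℤ) : ℤ⟦X⟧) = 1 := by
  rw [← Int.cast_mul, ← Units.val_mul, Int.units_mul_self, Units.val_one, Int.cast_one]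

/-- The finite form of the Jacobi triple product identity. -/
theorem prod_mul_prod_eq_sum_qBinom_mul_thetaTerm (s : ℤˣ) (a b n : ℕ) :
    (∏ m ∈ Finset.range n, (1 + ((s : ℤ) : ℤ⟦X⟧) * X ^ (a + (a + b) * m))) *
      (∏ m ∈ Finset.range n, (1 + ((s : ℤ) : ℤ⟦X⟧) * X ^ (b + (a + b) * m))) =
    ∑ p ∈ Finset.HasAntidiagonal.antidiagonal (n + n),
      qBinom ((X : ℤ⟦X⟧) ^ (a + b)) p.1 p.2 * thetaTerm s a b (p.1 - n) := by
  set N := a + b with hN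
  set σ : ℤ⟦X⟧ := ((s : ℤ) : ℤ⟦X⟧) with hσ
  have hσσ : σ * σ = 1 := intCast_units_mul_self s
  have hprod : ∀ n : ℕ, ∏ m ∈ Finset.range n, σ * X ^ (a + N * m) =
      σ ^ n * X ^ (a * n + N * n.choose 2) := by
    intro n
    induction n with
    | zero => simp
    | succ n ih =>
      rw [Finset.prod_range_succ, ih, Nat.choose_succ_succ' n 1, Nat.choose_one_right]
      ring
  have hM : (X : ℤ⟦X⟧) ^ (N * n * n) * (σ ^ n * X ^ (a * n + N * n.choose 2)) ≠ 0 := by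
    have : σ ≠ 0 := fun h => by simp [h] at hσσ
    exact mul_ne_zero (pow_ne_zero _ X_ne_zero)
      (mul_ne_zero (pow_ne_zero _ this) (pow_ne_zero _ X_ne_zero))
  refine mul_left_cancel₀ hM ?_
  -- With x = q^(Nn) negative powers of q are avoided: of the 2n factors, the first n, reversed,
  -- give the b-product and the last n the a-product, up to the monomial cancelled by `hM`.
  have key := prod_add_mul_pow_eq_sum_qBinom ((X : ℤ⟦X⟧) ^ N) (X ^ (N * n)) (σ * X ^ a) (n + n)
  rw [Finset.prod_range_add] at key
  have h1 : ∏ m ∈ Finset.range n, ((X : ℤ⟦X⟧) ^ (N * n) + σ * X ^ a * (X ^ N) ^ m) =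
      σ ^ n * X ^ (a * n + N * n.choose 2) *
        ∏ m ∈ Finset.range n, (1 + σ * X ^ (b + N * m)) := by
    rw [← hprod, ← Finset.prod_range_reflect (fun m => 1 + σ * X ^ (b + N * m)),
      ← Finset.prod_mul_distrib]
    refine Finset.prod_congr rfl fun m hm => ?_
    obtain ⟨c, rfl⟩ : ∃ c, n = m + 1 + c := Nat.exists_eq_add_of_le (Finset.mem_range.mp hm)
    rw [show m + 1 + c - 1 - m = c by omega]
    have : (X : ℤ⟦X⟧) ^ (N * (m + 1 + c)) = X ^ (a + N * m) * X ^ (b + N * c) := by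
      rw [← pow_add]
      congr 1
      rw [hN]; ring
    rw [this]
    linear_combination (-X ^ (a + N * m) * X ^ (b + N * c)) * hσσ
  have h2 : ∏ m ∈ Finset.range n, ((X : ℤ⟦X⟧) ^ (N * n) + σ * X ^ a * (X ^ N) ^ (n + m)) =
      X ^ (N * n * n) * ∏ m ∈ Finset.range n, (1 + σ * X ^ (a + N * m)) := by
    rw [pow_mul _ (N * n) n, ← Finset.card_range n, ← Finset.prod_const, Finset.card_range,
      ← Finset.prod_mul_distrib]
    refine Finset.prod_congr rfl fun m hm => ?_
    ring
  rw [h1, h2] at key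
  rw [Finset.mul_sum]
  trans ∑ p ∈ Finset.HasAntidiagonal.antidiagonal (n + n), qBinom ((X : ℤ⟦X⟧) ^ N) p.1 p.2 *
    (((X : ℤ⟦X⟧) ^ N) ^ p.1.choose 2 * (σ * X ^ a) ^ p.1 * (X ^ (N * n)) ^ p.2)
  · rw [← key]; ring
  · refine Finset.sum_congr rfl fun ⟨k, l⟩ hp => ?_
    rw [Finset.HasAntidiagonal.mem_antidiagonal] at hp
    simp only at hp ⊢
    have hl : (l : ℚ) = 2 * n - k := by
      have : ((k + l : ℕ) : ℚ) = ((n + n : ℕ) : ℚ) := congrArg _ hp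
      push_cast at this
      linarith
    have hsign : σ ^ k = σ ^ n * (((s ^ ((k : ℤ) - n) : ℤˣ) : ℤ) : ℤ⟦X⟧) := by
      have : s ^ k = s ^ n * s ^ ((k : ℤ) - n) := by
        rw [← zpow_natCast, ← zpow_natCast, ← zpow_add]
        congr 1; ring
      rw [hσ, ← Int.cast_pow, ← Int.cast_pow, ← Int.cast_mul, ← Units.val_pow_eq_pow_val,
        ← Units.val_pow_eq_pow_val, this, Units.val_mul]
    have hexp : N * k.choose 2 + a * k + N * n * l = N * n * n + (a * n + N * n.choose 2) +
        (a * tri ((k : ℤ) - n) + b * tri (-((k : ℤ) - n))) := by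
      qify
      simp only [tri_cast_rat, Nat.cast_choose_two, hl]
      rw [hN]
      push_cast
      ring
    unfold thetaTerm
    rw [mul_pow, ← pow_mul, ← pow_mul, ← pow_mul, hsign,
      show ∀ c : ℤ⟦X⟧, X ^ (N * k.choose 2) * (σ ^ n * c * X ^ (a * k)) * X ^ (N * n * l) =
        σ ^ n * c * X ^ (N * k.choose 2 + a * k + N * n * l) from fun c => by ring, hexp]
    ring

theorem X_pow_dvd_qFactorial_sub {N : ℕ} (hN : 0 < N) {D k : ℕ} (hk : D ≤ k) :
    (X : ℤ⟦X⟧) ^ D ∣ qFactorial ((X : ℤ⟦X⟧) ^ N) k - qFactorial ((X : ℤ⟦X⟧) ^ N) D := by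
  induction k, hk using Nat.le_induction with
  | base => simp
  | succ k hk ih =>
    rw [qFactorial_succ, show ∀ p d q : ℤ⟦X⟧, p * (1 - q) - d = (p - d) - p * q by intros; ring]
    refine dvd_sub ih (Dvd.dvd.mul_left ?_ _)
    rw [← pow_mul]
    exact pow_dvd_pow _ (by nlinarith)

/-- Modulo q^D all the factorials (Q;Q)_m with m ≥ D agree with the unit (Q;Q)_D, so the binomial is
its inverse. -/
theorem X_pow_dvd_qBinom_mul_qFactorial_sub_one {N : ℕ} (hN : 0 < N) {D k l n : ℕ}
    (hk : D ≤ k) (hl : D ≤ l) (hn : D ≤ n) :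
    (X : ℤ⟦X⟧) ^ D ∣
      qBinom ((X : ℤ⟦X⟧) ^ N) k l * qFactorial ((X : ℤ⟦X⟧) ^ N) n - 1 := by
  set Q : ℤ⟦X⟧ := X ^ N with hQ
  have hu : IsUnit (qFactorial Q D) := by
    rw [isUnit_iff_constantCoeff]
    simp [qFactorial, hQ, hN.ne']
  have hq : ∀ m, D ≤ m → Ideal.Quotient.mk (Ideal.span {(X : ℤ⟦X⟧) ^ D}) (qFactorial Q m) =
      Ideal.Quotient.mk (Ideal.span {(X : ℤ⟦X⟧) ^ D}) (qFactorial Q D) := fun m hm =>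
    Ideal.Quotient.eq.mpr (Ideal.mem_span_singleton.mpr (X_pow_dvd_qFactorial_sub hN hm))
  rw [← Ideal.mem_span_singleton, ← Ideal.Quotient.eq, map_mul, hq n hn, map_one]
  have h := congrArg (Ideal.Quotient.mk (Ideal.span {(X : ℤ⟦X⟧) ^ D})) (qBinom_mul_qFactorial Q k l)
  rw [map_mul, map_mul, hq k hk, hq l hl, hq (k + l) (by omega)] at h
  exact (hu.map _).mul_right_cancel (by rw [h, one_mul])

/-- The Jacobi triple product identity. -/
theorem theta_eq_qProd (s : ℤˣ) {a b : ℕ} (h : 0 < a + b) :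
    theta s a b = qProd s a (a + b) * qProd s b (a + b) * eulerProduct (a + b) := by
  have hlim := (((multipliable_qProd s a h).hasProd.tendsto_prod_nat.mul
    (multipliable_qProd s b h).hasProd.tendsto_prod_nat).mul
    (multipliable_qProd (-1) (a + b) h).hasProd.tendsto_prod_nat)
  have hsum : Tendsto (fun n : ℕ => ∑ j ∈ Finset.Icc (-(n : ℤ)) n, thetaTerm s a b j) atTop
      (nhds (theta s a b)) :=
    (hasSum_theta s h).comp (Finset.tendsto_Icc_neg (R := ℤ))
  rw [eulerProduct_eq_qProd]
  refine tendsto_nhds_unique ?_ hlim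
  simp only [prod_mul_prod_eq_sum_qBinom_mul_thetaTerm, prod_neg_one_eq_qFactorial]
  rw [WithPiTopology.tendsto_iff_coeff_tendsto] at hsum ⊢
  intro d
  refine (hsum d).congr' ?_
  -- If |k - n| ≤ d + 1, then k and l are at least d + 1 and the binomial can be replaced; otherwise
  -- the theta term itself is divisible by q^(d+1).
  filter_upwards [eventually_ge_atTop (2 * (d + 1))] with n hn
  have hre : ∑ j ∈ Finset.Icc (-(n : ℤ)) n, thetaTerm s a b j =
      ∑ p ∈ Finset.HasAntidiagonal.antidiagonal (n + n), thetaTerm s a b (p.1 - n) := by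
    refine Finset.sum_nbij' (fun j => ((j + n).toNat, (n - j).toNat)) (fun p => (p.1 : ℤ) - n)
      ?_ ?_ ?_ ?_ ?_
    · intro j hj
      simp only [Finset.mem_Icc, Finset.HasAntidiagonal.mem_antidiagonal] at *
      omega
    · rintro ⟨k, l⟩ hp
      simp only [Finset.mem_Icc, Finset.HasAntidiagonal.mem_antidiagonal] at *
      omega
    · intro j hj
      simp only [Finset.mem_Icc] at *
      omega
    · rintro ⟨k, l⟩ hp
      simp only [Finset.HasAntidiagonal.mem_antidiagonal, Prod.mk.injEq] at *
      omega
    · intro j hj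
      simp only [Finset.mem_Icc] at *
      congr 1
      omega
  have hdvd : (X : ℤ⟦X⟧) ^ (d + 1) ∣
      (∑ p ∈ Finset.HasAntidiagonal.antidiagonal (n + n), qBinom ((X : ℤ⟦X⟧) ^ (a + b)) p.1 p.2 *
        thetaTerm s a b (p.1 - n)) * qFactorial ((X : ℤ⟦X⟧) ^ (a + b)) n -
      ∑ p ∈ Finset.HasAntidiagonal.antidiagonal (n + n), thetaTerm s a b (p.1 - n) := by
    rw [Finset.sum_mul, ← Finset.sum_sub_distrib]
    refine Finset.dvd_sum fun ⟨k, l⟩ hp => ?_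
    rw [Finset.HasAntidiagonal.mem_antidiagonal] at hp
    simp only at hp ⊢
    rw [show ∀ g t q : ℤ⟦X⟧, g * t * q - t = (g * q - 1) * t by intros; ring]
    by_cases hj : ((k : ℤ) - n).natAbs ≤ d + 1
    · exact Dvd.dvd.mul_right (X_pow_dvd_qBinom_mul_qFactorial_sub_one h (by omega) (by omega)
        (by omega)) _
    · refine Dvd.dvd.mul_left (Dvd.dvd.mul_left (pow_dvd_pow _ ?_) _) _
      have := natAbs_le_theta_exponent h ((k : ℤ) - n)
      omega
  have := X_pow_dvd_iff.mp hdvd d (by omega)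
  rw [map_sub, sub_eq_zero] at this
  rw [hre, this]

end jacobi

/-! ### Theta series as quotients of the f_i -/

section thetaProducts
open PowerSeries

theorem eulerProduct_two_split {k : ℕ} (hk : 0 < k) :
    eulerProduct k = qProd (-1) k (2 * k) * eulerProduct (2 * k) := by
  rw [eulerProduct_eq_qProd, eulerProduct_eq_qProd, qProd_two_split _ _ hk, ← two_mul]

theorem eulerProduct_three_split {k : ℕ} (hk : 0 < k) :
    eulerProduct k = qProd (-1) k (3 * k) * qProd (-1) (2 * k) (3 * k) * eulerProduct (3 * k) := by
  rw [eulerProduct_eq_qProd, eulerProduct_eq_qProd, qProd_three_split _ _ hk, ← two_mul,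
    show k + 2 * k = 3 * k by ring]

theorem qProd_one_mul_eulerProduct {k : ℕ} (hk : 0 < k) :
    qProd 1 k k * eulerProduct k = eulerProduct (2 * k) := by
  rw [eulerProduct_eq_qProd, eulerProduct_eq_qProd, qProd_one_mul_qProd_neg_one _ hk]

theorem theta_one_eq {a b N : ℕ} (h : 0 < N) (hN : a + b = N) :
    theta 1 a b = qProd 1 a N * qProd 1 b N * eulerProduct N := by
  subst hN
  simpa using theta_eq_qProd 1 h

theorem theta_neg_one_eq {a b N : ℕ} (h : 0 < N) (hN : a + b = N) :
    theta (-1) a b = qProd (-1) a N * qProd (-1) b N * eulerProduct N := by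
  subst hN
  simpa using theta_eq_qProd (-1) h

theorem theta_neg_one_self_mul {k : ℕ} (hk : 0 < k) :
    theta (-1) k k * eulerProduct (2 * k) = eulerProduct k ^ 2 := by
  rw [theta_neg_one_eq (N := 2 * k) (by omega) (by ring), eulerProduct_two_split hk]
  ring

theorem theta_one_self_mul {k : ℕ} (hk : 0 < k) :
    theta 1 k k * theta (-1) k k * eulerProduct (4 * k) ^ 2 = eulerProduct (2 * k) ^ 4 := by
  have h1 := qProd_one_mul_qProd_neg_one k (N := 2 * k) (by omega)
  have h2 := eulerProduct_two_split (k := 2 * k) (by omega)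
  rw [theta_one_eq (N := 2 * k) (by omega) (by ring),
    theta_neg_one_eq (N := 2 * k) (by omega) (by ring)]
  rw [← mul_assoc, show 2 * 2 * k = 4 * k by ring] at h1 h2
  rw [show eulerProduct (2 * k) ^ 4 = eulerProduct (2 * k) ^ 2 * eulerProduct (2 * k) ^ 2 by ring]
  nth_rw 4 [h2]
  rw [← h1]
  ring

theorem theta_neg_one_five_mul {k : ℕ} (hk : 0 < k) :
    theta (-1) k (5 * k) * eulerProduct (2 * k) * eulerProduct (3 * k) =
      eulerProduct k * eulerProduct (6 * k) ^ 2 := by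
  have h2 := eulerProduct_three_split (k := 2 * k) (by omega)
  rw [eulerProduct_three_split hk, qProd_two_split _ k (N := 3 * k) (by omega),
    qProd_two_split _ (2 * k) (N := 3 * k) (by omega),
    theta_neg_one_eq (N := 6 * k) (by omega) (by ring)]
  rw [show k + 3 * k = 4 * k by ring, show 2 * k + 3 * k = 5 * k by ring]
  rw [show 2 * (3 * k) = 6 * k by ring]
  rw [show 2 * (2 * k) = 4 * k by ring, show 3 * (2 * k) = 6 * k by ring] at h2
  rw [h2]
  ring

theorem theta_one_five_mul {k : ℕ} (hk : 0 < k) :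
    theta 1 k (5 * k) * theta (-1) k (5 * k) * eulerProduct (12 * k) =
      eulerProduct (6 * k) ^ 2 * theta (-1) (2 * k) (10 * k) := by
  have h1 := qProd_one_mul_qProd_neg_one k (N := 6 * k) (by omega)
  have h2 := qProd_one_mul_qProd_neg_one (5 * k) (N := 6 * k) (by omega)
  rw [show 2 * (6 * k) = 12 * k by ring] at h1 h2
  rw [show 2 * (5 * k) = 10 * k by ring] at h2
  rw [theta_one_eq (N := 6 * k) (by omega) (by ring),
    theta_neg_one_eq (N := 6 * k) (by omega) (by ring),
    theta_neg_one_eq (N := 12 * k) (by omega) (by ring), ← h1, ← h2]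
  ring

/-- Euler's pentagonal case: the residues k, 2k and 0 mod 3k exhaust the multiples of k. -/
theorem theta_neg_one_two {k : ℕ} (hk : 0 < k) : theta (-1) k (2 * k) = eulerProduct k := by
  rw [theta_neg_one_eq (N := 3 * k) (by omega) (by ring), eulerProduct_three_split hk]

theorem theta_one_two_mul {k : ℕ} (hk : 0 < k) :
    theta 1 k (2 * k) * eulerProduct k * eulerProduct (6 * k) =
      eulerProduct (2 * k) * eulerProduct (3 * k) ^ 2 := by
  have h1 := qProd_one_mul_qProd_neg_one k (N := 3 * k) (by omega)
  have h2 := qProd_one_mul_qProd_neg_one (2 * k) (N := 3 * k) (by omega)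
  have h3 := eulerProduct_three_split (k := 2 * k) (by omega)
  rw [show 2 * (3 * k) = 6 * k by ring] at h1 h2
  rw [show 3 * (2 * k) = 6 * k by ring] at h3
  rw [theta_one_eq (N := 3 * k) (by omega) (by ring), eulerProduct_three_split hk, h3, ← h1, ← h2]
  ring

theorem theta_one_zero_mul {k : ℕ} (hk : 0 < k) :
    theta 1 0 k * eulerProduct k = 2 * eulerProduct (2 * k) ^ 2 := by
  rw [theta_one_eq (N := k) hk (by ring), qProd_one_zero hk, ← qProd_one_mul_eulerProduct hk]
  ring

theorem theta_five_seven_mul_theta_one_eleven :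
    theta (-1) 5 7 * theta (-1) 1 11 * eulerProduct 6 = theta (-1) 1 5 * eulerProduct 12 ^ 2 := by
  rw [theta_neg_one_eq (N := 12) (by omega) (by ring),
    theta_neg_one_eq (N := 12) (by omega) (by ring), theta_neg_one_eq (N := 6) (by omega) (by ring),
    qProd_two_split _ 1 (N := 6) (by omega), qProd_two_split _ 5 (N := 6) (by omega)]
  norm_num
  ring

end thetaProducts

/-! ### Dissections of quotients of the f_i -/

section etaIdentities
open PowerSeries

theorem theta_one_five_mul_eulerProduct :
    theta 1 1 5 * eulerProduct 1 * eulerProduct 4 * eulerProduct 6 =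
      eulerProduct 2 ^ 2 * eulerProduct 3 * eulerProduct 12 := by
  have a2 := theta_neg_one_five_mul (k := 1) (by omega)
  have a3 := theta_one_five_mul (k := 1) (by omega)
  have a4 := theta_neg_one_five_mul (k := 2) (by omega)
  norm_num at a2 a3 a4
  have n6 := eulerProduct_ne_zero (k := 6) (by omega)
  have n12 := eulerProduct_ne_zero (k := 12) (by omega)
  refine mul_left_cancel₀ (mul_ne_zero n12 (pow_ne_zero 2 n6)) ?_
  linear_combination (-theta 1 1 5 * eulerProduct 4 * eulerProduct 6 * eulerProduct 12) * a2 +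
    (eulerProduct 2 * eulerProduct 3 * eulerProduct 4 * eulerProduct 6) * a3 +
    (eulerProduct 6 ^ 2 * eulerProduct 2 * eulerProduct 3) * a4

theorem theta_one_three_three_mul_eulerProduct :
    theta 1 3 3 * eulerProduct 3 ^ 2 * eulerProduct 12 ^ 2 = eulerProduct 6 ^ 5 := by
  have a1 := theta_neg_one_self_mul (k := 3) (by omega)
  have a2 := theta_one_self_mul (k := 3) (by omega)
  norm_num at a1 a2
  linear_combination (-theta 1 3 3 * eulerProduct 12 ^ 2) * a1 + eulerProduct 6 * a2

/-- The `2`-dissection of `f₃³ / f₁`. -/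
theorem eulerProduct_three_pow_three_dissection :
    eulerProduct 2 ^ 2 * eulerProduct 3 ^ 3 * eulerProduct 4 * eulerProduct 12 =
      eulerProduct 1 * (eulerProduct 4 ^ 4 * eulerProduct 6 ^ 2 +
        X * eulerProduct 2 ^ 2 * eulerProduct 12 ^ 4) := by
  -- After clearing denominators f₃³/f₁ is θ₋(3,3)·θ₊(1,5), which splits as f₄² + q·θ₋(2,10)²; the
  -- subscript is the sign s.
  have key := theta_mul_theta (-1) 1 1 2 2 (by omega)
  have a1 := theta_neg_one_self_mul (k := 3) (by omega)
  have a4 := theta_neg_one_five_mul (k := 2) (by omega)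
  have a5 := theta_neg_one_two (k := 4) (by omega)
  have b := theta_one_five_mul_eulerProduct
  norm_num at key a1 a4 a5
  rw [theta_comm _ 8 4, a5] at key
  generalize eulerProduct 1 = f1 at *
  generalize eulerProduct 2 = f2 at *
  generalize eulerProduct 3 = f3 at *
  generalize eulerProduct 4 = f4 at *
  generalize eulerProduct 6 = f6 at *
  generalize eulerProduct 12 = f12 at *
  have c1 := congrArg₂ (· * ·) a1 b
  have c2 := congrArg (· ^ 2) a4
  linear_combination (-f4) * c1 + f1 * f4 ^ 2 * f6 ^ 2 * key + f1 * X * c2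

/-- The image of the `2`-dissection of `f₃³ / f₁` under `q ↦ -q`. -/
theorem eulerProduct_three_pow_three_dissection_neg :
    eulerProduct 1 * eulerProduct 4 ^ 2 * eulerProduct 6 ^ 9 =
      eulerProduct 2 * eulerProduct 3 ^ 3 * eulerProduct 12 ^ 2 *
        (eulerProduct 4 ^ 4 * eulerProduct 6 ^ 2 -
          X * eulerProduct 2 ^ 2 * eulerProduct 12 ^ 4) := by
  have key := theta_mul_theta 1 (-1) 1 2 2 (by omega)
  have a1 := theta_one_three_three_mul_eulerProduct
  have a2 := theta_neg_one_five_mul (k := 1) (by omega)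
  have a4 := theta_neg_one_five_mul (k := 2) (by omega)
  have a5 := theta_neg_one_two (k := 4) (by omega)
  norm_num at key a2 a4 a5
  rw [theta_comm _ 8 4, a5] at key
  generalize eulerProduct 1 = f1 at *
  generalize eulerProduct 2 = f2 at *
  generalize eulerProduct 3 = f3 at *
  generalize eulerProduct 4 = f4 at *
  generalize eulerProduct 6 = f6 at *
  generalize eulerProduct 12 = f12 at *
  have c1 := congrArg₂ (· * ·) a1 a2
  have c2 := congrArg (· ^ 2) a4
  linear_combination (-f4 ^ 2 * f6 ^ 2) * c1 + f2 * f3 ^ 3 * f12 ^ 2 * f4 ^ 2 * f6 ^ 2 * key -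
    f2 * f3 ^ 3 * f12 ^ 2 * X * c2

/-- With A = θ₋(5,7)² and B = q²θ₋(1,11)², the two theta products are A + B and A - B; the identity
is (A + B)² - (A - B)² = 4AB. -/
theorem eulerProduct_three_pow_eight_sub :
    eulerProduct 3 ^ 8 * eulerProduct 4 ^ 2 * eulerProduct 12 ^ 2 -
        eulerProduct 2 ^ 4 * eulerProduct 6 ^ 8 =
      4 * X ^ 2 * eulerProduct 1 ^ 2 * eulerProduct 3 ^ 2 * eulerProduct 12 ^ 8 := by
  have key := theta_mul_theta (-1) 1 2 1 1 (by omega)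
  have key' := theta_mul_theta 1 (-1) 2 1 1 (by omega)
  have a1 := theta_neg_one_self_mul (k := 3) (by omega)
  have a2 := theta_one_three_three_mul_eulerProduct
  have a3 := theta_one_two_mul (k := 2) (by omega)
  have a4 := theta_neg_one_two (k := 2) (by omega)
  have a5 := theta_five_seven_mul_theta_one_eleven
  have a6 := theta_neg_one_five_mul (k := 1) (by omega)
  norm_num at key key' a1 a3 a4 a6
  rw [theta_comm _ 7 5] at key key'
  rw [a4] at key'
  have n6 := eulerProduct_ne_zero (k := 6) (by omega)
  generalize eulerProduct 1 = f1 at *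
  generalize eulerProduct 2 = f2 at *
  generalize eulerProduct 3 = f3 at *
  generalize eulerProduct 4 = f4 at *
  generalize eulerProduct 6 = f6 at *
  generalize eulerProduct 12 = f12 at *
  have b4 : theta (-1) 3 3 * theta 1 2 4 * f2 * f12 = f3 ^ 2 * f4 * f6 := by
    refine mul_left_cancel₀ n6 ?_
    linear_combination (theta 1 2 4 * f2 * f12) * a1 + f3 ^ 2 * a3
  have b5 : theta (-1) 5 7 * theta (-1) 1 11 * f2 * f3 = f1 * f6 * f12 ^ 2 := by
    refine mul_left_cancel₀ n6 ?_
    linear_combination (f2 * f3) * a5 + f12 ^ 2 * a6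
  have c1 := congrArg (· ^ 2) b4
  have c2 := congrArg (· ^ 2) a2
  have c3 := congrArg (· ^ 2) b5
  have k1 := congrArg (· ^ 2) key
  have k2 := congrArg (· ^ 2) key'
  refine mul_left_cancel₀ (pow_ne_zero 2 n6) ?_
  linear_combination (-f3 ^ 4 * f12 ^ 2) * c1 + f2 ^ 4 * c2 + 4 * X ^ 2 * f3 ^ 2 * f12 ^ 4 * c3 +
    f2 ^ 2 * f3 ^ 4 * f12 ^ 4 * (k1 - k2)

/-- The `2`-dissection of `f₃ / f₁³`. -/
theorem eulerProduct_three_div_one_pow_three_dissection :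
    eulerProduct 2 ^ 9 * eulerProduct 3 * eulerProduct 12 ^ 2 =
      eulerProduct 1 ^ 3 * eulerProduct 4 ^ 2 * eulerProduct 6 *
        (eulerProduct 4 ^ 4 * eulerProduct 6 ^ 2 +
          3 * X * eulerProduct 2 ^ 2 * eulerProduct 12 ^ 4) := by
  have h1 := eulerProduct_three_pow_three_dissection
  have h2 := eulerProduct_three_pow_three_dissection_neg
  have h3 := eulerProduct_three_pow_eight_sub
  have n3 := eulerProduct_ne_zero (k := 3) (by omega)
  have n6 := eulerProduct_ne_zero (k := 6) (by omega)
  generalize eulerProduct 1 = f1 at *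
  generalize eulerProduct 2 = f2 at *
  generalize eulerProduct 3 = f3 at *
  generalize eulerProduct 4 = f4 at *
  generalize eulerProduct 6 = f6 at *
  generalize eulerProduct 12 = f12 at *
  have h1' := congrArg (· ^ 2) h1
  set U := f4 ^ 4 * f6 ^ 2
  set V := X * f2 ^ 2 * f12 ^ 4
  -- (U + 3V)(U - V) = (U + V)² - 4V²: the square comes from the dissection of f₃³/f₁, the term 4V²
  -- from `h3`. The factor U - V is then eliminated by `h2`.
  have b : f1 ^ 2 * f3 ^ 2 * ((U + 3 * V) * (U - V)) = f2 ^ 8 * f6 ^ 8 := by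
    linear_combination (-f3 ^ 2) * h1' + f2 ^ 4 * h3
  refine mul_left_cancel₀ (mul_ne_zero (pow_ne_zero 2 n3) (pow_ne_zero 8 n6)) ?_
  linear_combination (-f1 ^ 2 * f3 ^ 2 * (U + 3 * V)) * h2 - f2 * f3 ^ 3 * f12 ^ 2 * b

/-- The `2`-dissection of `1 / f₁⁴`. -/
theorem eulerProduct_one_pow_four_dissection :
    eulerProduct 2 ^ 14 * eulerProduct 8 ^ 4 =
      eulerProduct 1 ^ 4 * (eulerProduct 4 ^ 14 +
        4 * X * eulerProduct 2 ^ 4 * eulerProduct 4 ^ 2 * eulerProduct 8 ^ 8) := by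
  -- This is φ(q)² = φ(q²)² + 4qψ(q⁴)², where φ(q) = `theta 1 1 1` and 2ψ(q⁴) = `theta 1 0 4`.
  have key := theta_mul_theta 1 1 1 0 0 (by omega)
  have a1 := theta_neg_one_self_mul (k := 1) (by omega)
  have a2 := theta_one_self_mul (k := 1) (by omega)
  have a3 := theta_neg_one_self_mul (k := 2) (by omega)
  have a4 := theta_one_self_mul (k := 2) (by omega)
  have a5 := theta_one_zero_mul (k := 4) (by omega)
  norm_num at key a1 a2 a3 a4 a5
  generalize eulerProduct 1 = f1 at *
  generalize eulerProduct 2 = f2 at *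
  generalize eulerProduct 4 = f4 at *
  generalize eulerProduct 8 = f8 at *
  have b1 : theta 1 1 1 * f1 ^ 2 * f4 ^ 2 = f2 ^ 5 := by
    linear_combination (-theta 1 1 1 * f4 ^ 2) * a1 + f2 * a2
  have b2 : theta 1 2 2 * f2 ^ 2 * f8 ^ 2 = f4 ^ 5 := by
    linear_combination (-theta 1 2 2 * f8 ^ 2) * a3 + f4 * a4
  have c1 := congrArg (· ^ 2) b1
  have c2 := congrArg (· ^ 2) b2
  have c5 := congrArg (· ^ 2) a5
  linear_combination (-f2 ^ 4 * f8 ^ 4) * c1 + f1 ^ 4 * f4 ^ 4 * c2 +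
    X * f1 ^ 4 * f4 ^ 2 * f2 ^ 4 * f8 ^ 4 * c5 + f1 ^ 4 * f4 ^ 4 * f2 ^ 4 * f8 ^ 4 * key

/-- The `3`-dissection of `f₂² / f₁`. -/
theorem eulerProduct_two_sq_div_one_dissection :
    eulerProduct 2 ^ 2 * eulerProduct 3 * eulerProduct 9 * eulerProduct 18 =
      eulerProduct 1 * (eulerProduct 6 * eulerProduct 9 ^ 3 +
        X * eulerProduct 3 * eulerProduct 18 ^ 3) := by
  have key := theta_one_three_dissection 1 (by omega)
  have a1 := theta_one_zero_mul (k := 1) (by omega)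
  have a2 := theta_one_zero_mul (k := 9) (by omega)
  have a3 := theta_one_two_mul (k := 3) (by omega)
  norm_num at key a1 a2 a3
  generalize eulerProduct 1 = f1 at *
  generalize eulerProduct 2 = f2 at *
  generalize eulerProduct 3 = f3 at *
  generalize eulerProduct 6 = f6 at *
  generalize eulerProduct 9 = f9 at *
  generalize eulerProduct 18 = f18 at *
  have n : (2 : ℤ⟦X⟧) ≠ 0 := fun h => by
    have h' := congrArg constantCoeff h
    rw [map_ofNat, map_zero] at h'
    exact absurd h' (by norm_num)
  refine mul_left_cancel₀ n ?_
  linear_combination (-f3 * f9 * f18) * a1 + f1 * f3 * f9 * f18 * key + 2 * f1 * f9 * a3 +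
    f1 * X * f3 * f18 * a2

/-- The `2`-dissection of `f₉ / f₁`. -/
theorem eulerProduct_nine_div_one_dissection :
    eulerProduct 9 * eulerProduct 2 ^ 3 * eulerProduct 6 * eulerProduct 12 * eulerProduct 36 =
      eulerProduct 1 * (eulerProduct 2 * eulerProduct 12 ^ 4 * eulerProduct 18 +
        X * eulerProduct 4 ^ 2 * eulerProduct 6 ^ 2 * eulerProduct 36 ^ 2) := by
  have h1 := congrArg (expand 3 (by norm_num)) eulerProduct_three_pow_three_dissection
  have h2 := eulerProduct_two_sq_div_one_dissection
  have h3 := congrArg (expand 2 (by norm_num)) eulerProduct_two_sq_div_one_dissection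
  simp only [map_mul, map_add, map_pow, expand_X, expand_eulerProduct, Nat.ofNat_pos,
    Nat.one_pos] at h1 h3
  norm_num at h1 h3
  have n3 := eulerProduct_ne_zero (k := 3) (by omega)
  have n18 := eulerProduct_ne_zero (k := 18) (by omega)
  generalize eulerProduct 1 = f1 at *
  generalize eulerProduct 2 = f2 at *
  generalize eulerProduct 3 = f3 at *
  generalize eulerProduct 4 = f4 at *
  generalize eulerProduct 6 = f6 at *
  generalize eulerProduct 9 = f9 at *
  generalize eulerProduct 12 = f12 at *
  generalize eulerProduct 18 = f18 at *
  generalize eulerProduct 36 = f36 at *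
  -- In the 3-dissection `h2` of f₂²/f₁, split f₉³/f₃ by `h1`; the odd terms then recombine, by
  -- `h3`, into a multiple of f₄²/f₂.
  refine mul_left_cancel₀ (mul_ne_zero n3 n18) ?_
  linear_combination f2 * f6 * f12 * f36 * h2 + f1 * f2 * h1 - f1 * f3 * f6 * f36 * X * h3

end etaIdentities

/-! ### The generating function -/

section generatingFunction
open PowerSeries

/-- Indexing every f_k by all i, with trivial factors, lets the products be compared factor by
factor. -/
theorem hasProd_eulerProduct_ite {k : ℕ} (hk : 0 < k) :
    HasProd (fun i : ℕ => if k ∣ i + 1 then 1 - (X : ℤ⟦X⟧) ^ (i + 1) else 1)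
      (eulerProduct k) := by
  have hm : Multipliable (fun i : ℕ => if k ∣ i + 1 then 1 - (X : ℤ⟦X⟧) ^ (i + 1) else 1) := by
    refine (multipliable_one_add_of_X_pow_dvd
      (g := fun i : ℕ => if k ∣ i + 1 then -(X : ℤ⟦X⟧) ^ (i + 1) else 0) fun m => ?_).congr
      fun i => ?_
    · split_ifs
      · exact (pow_dvd_pow _ (Nat.le_succ m)).neg_right
      · exact dvd_zero _
    · split_ifs <;> ring
  convert hm.hasProd using 1
  have hinj : Function.Injective fun m : ℕ => k * m + (k - 1) := fun m n h => by
    simpa [hk.ne'] using h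
  rw [← hinj.tprod_eq]
  · unfold eulerProduct
    refine tprod_congr fun m => ?_
    have e : k * m + (k - 1) + 1 = k + k * m := by omega
    simp only [e]
    rw [if_pos (Dvd.intro (1 + m) (by ring)), pow_add, pow_mul]
  · intro i hi
    rw [Function.mem_mulSupport] at hi
    have hd : k ∣ i + 1 := by
      by_contra h
      exact hi (if_neg h)
    obtain ⟨c, hc⟩ := hd
    rcases c with _ | c
    · omega
    · refine ⟨c, ?_⟩
      simp only
      rw [mul_add, mul_one] at hc
      omega

theorem mk_regularPartitionCount_four_nine_mul :
    PowerSeries.mk (fun n => (regularPartitionCount 4 9 n : ℤ)) *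
      (eulerProduct 1 * eulerProduct 36) = eulerProduct 4 * eulerProduct 9 := by
  have h := (Nat.Partition.hasProd_powerSeriesMk_card_restricted ℤ
    (fun d => ¬ 4 ∣ d ∧ ¬ 9 ∣ d)).mul
    ((hasProd_eulerProduct_ite (k := 1) (by omega)).mul
      (hasProd_eulerProduct_ite (k := 36) (by omega)))
  have hgeom : ∀ i : ℕ, (∑' j : ℕ, (X : ℤ⟦X⟧) ^ ((i + 1) * j)) * (1 - X ^ (i + 1)) = 1 := by
    intro i
    simp_rw [pow_mul]
    exact WithPiTopology.tsum_pow_mul_one_sub_of_constantCoeff_eq_zero (by simp)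
  have h' := (hasProd_eulerProduct_ite (k := 4) (by omega)).mul
    (hasProd_eulerProduct_ite (k := 9) (by omega))
  refine h.tprod_eq.symm.trans ((tprod_congr fun i => ?_).trans h'.tprod_eq)
  have h36 : 36 ∣ i + 1 ↔ 4 ∣ i + 1 ∧ 9 ∣ i + 1 := by omega
  simp only [h36, one_dvd, if_true]
  by_cases h4 : 4 ∣ i + 1 <;> by_cases h9 : 9 ∣ i + 1 <;> simp [h4, h9, hgeom]

end generatingFunction

/-! ### Even and odd parts; reduction modulo a prime -/

section dissection
open PowerSeries

theorem coeff_even_add_X_mul {R : Type*} [CommRing R] (A B : R⟦X⟧) (n : ℕ) :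
    coeff (2 * n) (expand 2 two_ne_zero A + X * expand 2 two_ne_zero B) = coeff n A := by
  rw [map_add, coeff_expand_mul]
  rcases n with _ | n
  · simp
  · rw [show 2 * (n + 1) = 2 * n + 1 + 1 by ring, coeff_succ_X_mul,
      coeff_expand_of_not_dvd _ _ _ (by omega), add_zero]

theorem coeff_odd_add_X_mul {R : Type*} [CommRing R] (A B : R⟦X⟧) (n : ℕ) :
    coeff (2 * n + 1) (expand 2 two_ne_zero A + X * expand 2 two_ne_zero B) = coeff n B := by
  rw [map_add, coeff_succ_X_mul, coeff_expand_mul, coeff_expand_of_not_dvd _ _ _ (by omega),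
    zero_add]

theorem even_odd_parts_mul_eq {a : ℕ → ℤ} (D U V : ℤ⟦X⟧)
    (h : PowerSeries.mk a * expand 2 two_ne_zero D =
      expand 2 two_ne_zero U + X * expand 2 two_ne_zero V) :
    PowerSeries.mk (fun n => a (2 * n)) * D = U ∧
      PowerSeries.mk (fun n => a (2 * n + 1)) * D = V := by
  have ha : PowerSeries.mk a = expand 2 two_ne_zero (PowerSeries.mk fun n => a (2 * n)) +
      X * expand 2 two_ne_zero (PowerSeries.mk fun n => a (2 * n + 1)) := by
    ext m
    obtain ⟨n, rfl | rfl⟩ := Nat.even_or_odd' m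
    · rw [coeff_even_add_X_mul, coeff_mk, coeff_mk]
    · rw [coeff_odd_add_X_mul, coeff_mk, coeff_mk]
  rw [ha, add_mul, mul_assoc, ← map_mul, ← map_mul] at h
  constructor
  · ext n
    rw [← coeff_even_add_X_mul _ (PowerSeries.mk (fun n => a (2 * n + 1)) * D), h,
      coeff_even_add_X_mul]
  · ext n
    rw [← coeff_odd_add_X_mul (PowerSeries.mk (fun n => a (2 * n)) * D), h,
      coeff_odd_add_X_mul]

/-- Reduction of integer power series modulo `p`. -/
noncomputable def reduceMod (p : ℕ) : ℤ⟦X⟧ →+* (ZMod p)⟦X⟧ :=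
  PowerSeries.map (Int.castRingHom (ZMod p))

/-- Frobenius: F(q)^p = F(q^p) over ZMod p. -/
theorem reduceMod_eulerProduct_pow (p : ℕ) [Fact p.Prime] {i : ℕ} (hi : 0 < i) :
    reduceMod p (eulerProduct i) ^ p = reduceMod p (eulerProduct (p * i)) := by
  have hp : p ≠ 0 := (Fact.out : p.Prime).ne_zero
  rw [← expand_eulerProduct hp hi]
  unfold reduceMod
  rw [map_expand]
  have := MvPowerSeries.map_frobenius_expand p hp
    (f := PowerSeries.map (Int.castRingHom (ZMod p)) (eulerProduct i))
  rw [ZMod.frobenius_zmod, MvPowerSeries.map_id] at this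
  exact this.symm

theorem reduceMod_eq_iff {p : ℕ} {A B : ℤ⟦X⟧} :
    reduceMod p A = reduceMod p B ↔ ∀ n, coeff n A ≡ coeff n B [ZMOD p] := by
  simp only [PowerSeries.ext_iff, reduceMod, coeff_map, eq_intCast, ZMod.intCast_eq_intCast_iff]

end dissection

/-! ### Counts along progressions modulo 2, 4 and 8 -/

section regularPartitionCount
open PowerSeries

theorem mk_regularPartitionCount_two_mul_add_one :
    PowerSeries.mk (fun n => (regularPartitionCount 4 9 (2 * n + 1) : ℤ)) *
      (eulerProduct 1 ^ 3 * eulerProduct 6) = eulerProduct 2 ^ 3 * eulerProduct 3 := by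
  have h0 := mk_regularPartitionCount_four_nine_mul
  have hA := eulerProduct_nine_div_one_dissection
  have n1 := eulerProduct_ne_zero (k := 1) (by omega)
  have n3 := eulerProduct_ne_zero (k := 3) (by omega)
  have n18 := eulerProduct_ne_zero (k := 18) (by omega)
  -- The three series are the common denominator and the even and odd parts, each written in q in
  -- place of q².
  have h := (even_odd_parts_mul_eq (a := fun n => (regularPartitionCount 4 9 n : ℤ))
    (eulerProduct 1 ^ 3 * eulerProduct 3 * eulerProduct 6 * eulerProduct 18 ^ 2)
    (eulerProduct 1 * eulerProduct 2 * eulerProduct 6 ^ 4 * eulerProduct 9)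
    (eulerProduct 2 ^ 3 * eulerProduct 3 ^ 2 * eulerProduct 18 ^ 2) ?_).2
  · refine mul_right_cancel₀ (mul_ne_zero n3 (pow_ne_zero 2 n18)) ?_
    linear_combination h
  · simp only [map_mul, map_pow, expand_eulerProduct, Nat.ofNat_pos, Nat.one_pos]
    norm_num
    refine mul_left_cancel₀ n1 ?_
    linear_combination
      (eulerProduct 2 ^ 3 * eulerProduct 6 * eulerProduct 12 * eulerProduct 36) * h0 +
      eulerProduct 4 * hA

theorem mk_regularPartitionCount_four_mul :
    PowerSeries.mk (fun n => (regularPartitionCount 4 9 (2 * (2 * n) + 1) : ℤ)) *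
        (eulerProduct 1 ^ 6 * eulerProduct 6 ^ 2) = eulerProduct 2 ^ 6 * eulerProduct 3 ^ 2 ∧
    PowerSeries.mk (fun n => (regularPartitionCount 4 9 (2 * (2 * n + 1) + 1) : ℤ)) *
        eulerProduct 1 ^ 4 = 3 * (eulerProduct 2 ^ 2 * eulerProduct 6 ^ 2) := by
  have h0 := mk_regularPartitionCount_two_mul_add_one
  have hB := eulerProduct_three_div_one_pow_three_dissection
  have n1 := eulerProduct_ne_zero (k := 1) (by omega)
  have n3 := eulerProduct_ne_zero (k := 3) (by omega)
  have n6 := eulerProduct_ne_zero (k := 6) (by omega)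
  have h := even_odd_parts_mul_eq
    (a := fun n => (regularPartitionCount 4 9 (2 * n + 1) : ℤ))
    (eulerProduct 1 ^ 9 * eulerProduct 3 * eulerProduct 6 ^ 2)
    (eulerProduct 1 ^ 3 * eulerProduct 2 ^ 6 * eulerProduct 3 ^ 3)
    (3 * (eulerProduct 1 ^ 5 * eulerProduct 2 ^ 2 * eulerProduct 3 * eulerProduct 6 ^ 4)) ?_
  · constructor
    · refine mul_right_cancel₀ (mul_ne_zero (pow_ne_zero 3 n1) n3) ?_
      linear_combination h.1
    · refine mul_right_cancel₀
        (mul_ne_zero (mul_ne_zero (pow_ne_zero 5 n1) n3) (pow_ne_zero 2 n6)) ?_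
      linear_combination h.2
  · simp only [map_mul, map_pow, map_ofNat, expand_eulerProduct, Nat.ofNat_pos, Nat.one_pos]
    norm_num
    refine mul_left_cancel₀ (mul_ne_zero (pow_ne_zero 3 n1) n6) ?_
    linear_combination
      (eulerProduct 2 ^ 9 * eulerProduct 6 * eulerProduct 12 ^ 2) * h0 +
      eulerProduct 2 ^ 3 * eulerProduct 6 * hB

/-- The dissection of f₃/f₁³ is squared; 6 = 2·3 is the coefficient of the cross term. -/
theorem mk_regularPartitionCount_eight_mul_add_five :
    PowerSeries.mk (fun n => (regularPartitionCount 4 9 (8 * n + 5) : ℤ)) *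
      eulerProduct 1 ^ 10 = 6 * (eulerProduct 2 ^ 8 * eulerProduct 3 ^ 2) := by
  have h0 := mk_regularPartitionCount_four_mul.1
  have hB := congrArg (· ^ 2) eulerProduct_three_div_one_pow_three_dissection
  have n1 := eulerProduct_ne_zero (k := 1) (by omega)
  have n3 := eulerProduct_ne_zero (k := 3) (by omega)
  have n6 := eulerProduct_ne_zero (k := 6) (by omega)
  have h := (even_odd_parts_mul_eq
    (a := fun n => (regularPartitionCount 4 9 (2 * (2 * n) + 1) : ℤ))
    (eulerProduct 1 ^ 12 * eulerProduct 3 ^ 2 * eulerProduct 6 ^ 4)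
    (eulerProduct 2 ^ 4 * eulerProduct 3 ^ 2 *
      (eulerProduct 2 ^ 8 * eulerProduct 3 ^ 4 +
        9 * X * eulerProduct 1 ^ 4 * eulerProduct 6 ^ 8))
    (6 * (eulerProduct 1 ^ 2 * eulerProduct 2 ^ 8 * eulerProduct 3 ^ 4 * eulerProduct 6 ^ 4)) ?_).2
  · refine mul_right_cancel₀ (mul_ne_zero (mul_ne_zero (pow_ne_zero 2 n1) (pow_ne_zero 2 n3))
      (pow_ne_zero 4 n6)) ?_
    have e : ∀ n, 2 * (2 * (2 * n + 1)) + 1 = 8 * n + 5 := fun n => by ring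
    simp only [e] at h
    linear_combination h
  · simp only [map_mul, map_add, map_pow, map_ofNat, expand_X, expand_eulerProduct, Nat.ofNat_pos,
      Nat.one_pos]
    norm_num
    have n2 := eulerProduct_ne_zero (k := 2) (by omega)
    refine mul_left_cancel₀ (mul_ne_zero (pow_ne_zero 6 n1)
      (mul_ne_zero (pow_ne_zero 6 n2) (pow_ne_zero 2 n6))) ?_
    linear_combination
      (eulerProduct 2 ^ 18 * eulerProduct 6 ^ 2 * eulerProduct 12 ^ 4) * h0 +
      eulerProduct 2 ^ 6 * eulerProduct 6 ^ 2 * hB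

theorem mk_regularPartitionCount_eight_mul_add_seven :
    PowerSeries.mk (fun n => (regularPartitionCount 4 9 (8 * n + 7) : ℤ)) *
      eulerProduct 1 ^ 8 =
        12 * (eulerProduct 2 ^ 2 * eulerProduct 3 ^ 2 * eulerProduct 4 ^ 4) := by
  have h0 := mk_regularPartitionCount_four_mul.2
  have hC := eulerProduct_one_pow_four_dissection
  have n1 := eulerProduct_ne_zero (k := 1) (by omega)
  have n4 := eulerProduct_ne_zero (k := 4) (by omega)
  have h := (even_odd_parts_mul_eq
    (a := fun n => (regularPartitionCount 4 9 (2 * (2 * n + 1) + 1) : ℤ))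
    (eulerProduct 1 ^ 14 * eulerProduct 4 ^ 4)
    (3 * (eulerProduct 1 ^ 2 * eulerProduct 3 ^ 2 * eulerProduct 2 ^ 14))
    (12 * (eulerProduct 1 ^ 6 * eulerProduct 2 ^ 2 * eulerProduct 3 ^ 2 * eulerProduct 4 ^ 8))
    ?_).2
  · refine mul_right_cancel₀ (mul_ne_zero (pow_ne_zero 6 n1) (pow_ne_zero 4 n4)) ?_
    have e : ∀ n, 2 * (2 * (2 * n + 1) + 1) + 1 = 8 * n + 7 := fun n => by ring
    simp only [e] at h
    linear_combination h
  · simp only [map_mul, map_pow, map_ofNat, expand_eulerProduct, Nat.ofNat_pos, Nat.one_pos]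
    norm_num
    refine mul_left_cancel₀ (pow_ne_zero 4 n1) ?_
    linear_combination (eulerProduct 2 ^ 14 * eulerProduct 8 ^ 4) * h0 +
      3 * eulerProduct 2 ^ 2 * eulerProduct 6 ^ 2 * hC

/-- A power series `W` with `∑ b(8n+7) qⁿ = 12 W`, together with its reduction modulo `2`. -/
theorem exists_mk_regularPartitionCount_eight_mul_add_seven_eq :
    ∃ W : ℤ⟦X⟧, (∀ n, (regularPartitionCount 4 9 (8 * n + 7) : ℤ) = 12 * coeff n W) ∧
      ∀ n, coeff n W ≡
        coeff n (expand 2 two_ne_zero (eulerProduct 1 ^ 6 * eulerProduct 3)) [ZMOD 2] := by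
  have h := mk_regularPartitionCount_eight_mul_add_seven
  obtain ⟨u, hu⟩ := (isUnit_eulerProduct (k := 1) (by omega)).exists_right_inv
  have hu8 : eulerProduct 1 ^ 8 * u ^ 8 = 1 := by rw [← mul_pow, hu, one_pow]
  set W : ℤ⟦X⟧ := eulerProduct 2 ^ 2 * eulerProduct 3 ^ 2 * eulerProduct 4 ^ 4 * u ^ 8 with hW
  refine ⟨W, fun n => ?_, ?_⟩
  · have : PowerSeries.mk (fun n => (regularPartitionCount 4 9 (8 * n + 7) : ℤ)) = C 12 * W := by
      rw [map_ofNat]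
      linear_combination u ^ 8 * h -
        PowerSeries.mk (fun n => (regularPartitionCount 4 9 (8 * n + 7) : ℤ)) * hu8
    rw [← coeff_C_mul, ← this, coeff_mk]
  · have hW8 : W * eulerProduct 1 ^ 8 =
        eulerProduct 2 ^ 2 * eulerProduct 3 ^ 2 * eulerProduct 4 ^ 4 := by
      linear_combination (eulerProduct 2 ^ 2 * eulerProduct 3 ^ 2 * eulerProduct 4 ^ 4) * hu8
    refine reduceMod_eq_iff.mp ?_
    have r := congrArg (reduceMod 2) hW8
    have r1 := reduceMod_eulerProduct_pow 2 (i := 1) (by omega)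
    have r2 := reduceMod_eulerProduct_pow 2 (i := 2) (by omega)
    have r3 := reduceMod_eulerProduct_pow 2 (i := 3) (by omega)
    have hunit := (isUnit_eulerProduct (k := 2) (by omega)).map (reduceMod 2)
    simp only [map_mul, map_pow, expand_eulerProduct, Nat.ofNat_pos, Nat.one_pos] at r ⊢
    norm_num at r1 r2 r3 ⊢
    -- Mod 2: f₁⁸ ≡ f₂⁴, f₃² ≡ f₆ and f₄ ≡ f₂², so W·f₂⁴ ≡ f₂¹⁰f₆.
    rw [show reduceMod 2 (eulerProduct 1) ^ 8 = (reduceMod 2 (eulerProduct 1) ^ 2) ^ 4 by ring,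
      r1, r3, ← r2] at r
    refine (hunit.pow 4).mul_right_cancel ?_
    rw [r]
    ring

theorem regularPartitionCount_eight_mul_add_five_modEq (n : ℕ) :
    regularPartitionCount 4 9 (8 * n + 5) ≡ 5 * regularPartitionCount 4 9 (4 * n + 3) [MOD 9] := by
  have h5 := mk_regularPartitionCount_eight_mul_add_five
  have h3 := mk_regularPartitionCount_four_mul.2
  have e : ∀ n, 2 * (2 * n + 1) + 1 = 4 * n + 3 := fun n => by ring
  simp only [e] at h3
  obtain ⟨u, hu⟩ := (isUnit_eulerProduct (k := 1) (by omega)).exists_right_inv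
  have hu4 : eulerProduct 1 ^ 4 * u ^ 4 = 1 := by rw [← mul_pow, hu, one_pow]
  have hu10 : eulerProduct 1 ^ 10 * u ^ 10 = 1 := by rw [← mul_pow, hu, one_pow]
  set Y : ℤ⟦X⟧ := eulerProduct 2 ^ 2 * eulerProduct 6 ^ 2 * u ^ 4 with hY
  set Z : ℤ⟦X⟧ := eulerProduct 2 ^ 8 * eulerProduct 3 ^ 2 * u ^ 10 with hZ
  have cY : (regularPartitionCount 4 9 (4 * n + 3) : ℤ) = 3 * coeff n Y := by
    have : PowerSeries.mk (fun n => (regularPartitionCount 4 9 (4 * n + 3) : ℤ)) = C 3 * Y := by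
      rw [map_ofNat]
      linear_combination u ^ 4 * h3 -
        PowerSeries.mk (fun n => (regularPartitionCount 4 9 (4 * n + 3) : ℤ)) * hu4
    rw [← coeff_C_mul, ← this, coeff_mk]
  have cZ : (regularPartitionCount 4 9 (8 * n + 5) : ℤ) = 6 * coeff n Z := by
    have : PowerSeries.mk (fun n => (regularPartitionCount 4 9 (8 * n + 5) : ℤ)) = C 6 * Z := by
      rw [map_ofNat]
      linear_combination u ^ 10 * h5 -
        PowerSeries.mk (fun n => (regularPartitionCount 4 9 (8 * n + 5) : ℤ)) * hu10
    rw [← coeff_C_mul, ← this, coeff_mk]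
  -- Mod 3, f₃ ≡ f₁³ and f₆ ≡ f₂³ turn both series into f₂⁸/f₁⁴. Then 6Z - 5·3Y = 6(Z - Y) - 9Y is
  -- divisible by 9.
  have hZY : reduceMod 3 Z = reduceMod 3 Y := by
    have r1 := reduceMod_eulerProduct_pow 3 (i := 1) (by omega)
    have r2 := reduceMod_eulerProduct_pow 3 (i := 2) (by omega)
    have ru := congrArg (reduceMod 3) hu
    norm_num at r1 r2 ru
    simp only [hY, hZ, map_mul, map_pow, ← r1, ← r2]
    have ru6 : reduceMod 3 (eulerProduct 1) ^ 6 * reduceMod 3 u ^ 6 = 1 := by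
      rw [← mul_pow, ru, one_pow]
    linear_combination (reduceMod 3 (eulerProduct 2) ^ 8 * reduceMod 3 u ^ 4) * ru6
  have := reduceMod_eq_iff.mp hZY n
  rw [← Int.natCast_modEq_iff]
  push_cast
  rw [cY, cZ]
  rw [Int.modEq_iff_dvd] at *
  push_cast at *
  omega

end regularPartitionCount

theorem theorem1p3 :
    (∀ n : ℕ, regularPartitionCount 4 9 (8 * n + 7) ≡ 0 [MOD 12]) ∧
    (∀ n : ℕ, regularPartitionCount 4 9 (16 * n + 15) ≡ 0 [MOD 8]) ∧
    SeriesModEq 8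
      (PowerSeries.mk fun n : ℕ => (regularPartitionCount 4 9 (16 * n + 7) : ℤ))
      (4 * eulerProduct 1 ^ 6 * eulerProduct 3) ∧
    (∀ n : ℕ, regularPartitionCount 4 9 (32 * n + 29) ≡
      5 * regularPartitionCount 4 9 (16 * n + 15) [MOD 9]) := by
  obtain ⟨W, hW, hW2⟩ := exists_mk_regularPartitionCount_eight_mul_add_seven_eq
  refine ⟨fun n => ?_, fun n => ?_, fun n => ?_, fun n => ?_⟩
  · have := hW n
    rw [Nat.modEq_zero_iff_dvd]
    omega
  · have h := hW (2 * n + 1)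
    have h2 := hW2 (2 * n + 1)
    -- W is a series in q² mod 2, so its odd coefficients are even and 24 divides the count.
    rw [PowerSeries.coeff_expand_of_not_dvd _ _ _ (by omega), Int.modEq_zero_iff_dvd] at h2
    rw [show 8 * (2 * n + 1) + 7 = 16 * n + 15 by ring] at h
    rw [Nat.modEq_zero_iff_dvd]
    omega
  · have h := hW (2 * n)
    have h2 := hW2 (2 * n)
    rw [PowerSeries.coeff_expand_mul, Int.modEq_iff_dvd] at h2
    rw [show 8 * (2 * n) + 7 = 16 * n + 7 by ring] at h
    rw [PowerSeries.coeff_mk, h, mul_assoc, show (4 : ℤ⟦X⟧) = PowerSeries.C 4 by simp,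
      PowerSeries.coeff_C_mul, Int.modEq_iff_dvd]
    omega
  · have h := regularPartitionCount_eight_mul_add_five_modEq (4 * n + 3)
    rwa [show 8 * (4 * n + 3) + 5 = 32 * n + 29 by ring,
      show 4 * (4 * n + 3) + 3 = 16 * n + 15 by ring] at h
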